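/- All groups are finite. The commuting graph $\Gamma(G)$ of a group $G$ is the graph whose vertices are the noncentral elements of $G$, two distinct vertices being adjacent if and only if they commute in $G$. An $A$-group is a group all of whose Sylow subgroups are abelian. A group $X$ is a Frobenius group with kernel $N$ if $N$ is a nontrivial normal subgroup of $X$ having a nontrivial complement $A$ in $X$ such that $ana^{-1}\neq n$ for all $1\neq a\in A$ and $1\neq n\in N$. A group $X$ is 2-Frobenius if it has normal subgroups $K\le H$ such that $H$ is a Frobenius group with kernel $K$ and $X/K$ is a Frobenius group with kernel $H/K$. **Lemma 3.3.** Let $G$ be a finite solvable nonabelian $A$-group of derived length $2$ such that $G/Z(G)$ is neither a Frobenius group nor a 2-Frobenius group. Then $\Gamma(G)$ is connected with diameter at most $4$. Moreover, this bound is sharp: the group $C_{15}\rtimes C_4$ of order $60$ in which a generator of $C_4$ acts on $C_{15}$ by $x\mapsto x^2$ (this is SmallGroup(60,7) of the GAP Small Groups Library) satisfies all of these hypotheses, and its commuting graph is connected with diameter exactly $4$. -/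

import Mathlib

/-- The commuting graph of `G`: its vertices are the noncentral elements of `G`, and two distinct
vertices are adjacent if and only if they commute in `G`. -/
def commutingGraph (G : Type*) [Group G] : SimpleGraph {g : G // g ∉ Subgroup.center G} where
  Adj x y := x ≠ y ∧ (x : G) * (y : G) = (y : G) * (x : G)
  symm := ⟨fun _ _ h => ⟨h.1.symm, h.2.symm⟩⟩
  loopless := ⟨fun _ h => h.1 rfl⟩

/-- An `A`-group: every Sylow subgroup (for every prime) is abelian. -/
def IsAGroup (G : Type*) [Group G] : Prop :=
  ∀ p : ℕ, p.Prime → ∀ P : Sylow p G, ∀ x ∈ P, ∀ y ∈ P, x * y = y * x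

/-- `G` has derived length `n`: the number `n` is the least index at which the derived series of
`G` reaches the trivial subgroup. -/
def HasDerivedLength (G : Type*) [Group G] (n : ℕ) : Prop :=
  IsLeast {k : ℕ | derivedSeries G k = ⊥} n

/-- `G` is a Frobenius group with kernel `N`: the subgroup `N` is normal and nontrivial, and it has
a nontrivial complement `A` in `G` such that no nontrivial element of `A` fixes a nontrivial
element of `N` under conjugation. -/
def IsFrobeniusWithKernel (G : Type*) [Group G] (N : Subgroup G) : Prop :=
  N.Normal ∧ N ≠ ⊥ ∧ ∃ A : Subgroup G, A ≠ ⊥ ∧ Subgroup.IsComplement' N A ∧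
    ∀ a ∈ A, a ≠ 1 → ∀ n ∈ N, n ≠ 1 → a * n * a⁻¹ ≠ n

/-- `G` is a Frobenius group. -/
def IsFrobenius (G : Type*) [Group G] : Prop :=
  ∃ N : Subgroup G, IsFrobeniusWithKernel G N

/-- `G` is a 2-Frobenius group: there are normal subgroups `K ≤ H` of `G` such that `H` is a
Frobenius group with kernel `K` and `G ⧸ K` is a Frobenius group with kernel `H / K`. -/
def IsTwoFrobenius (G : Type*) [Group G] : Prop :=
  ∃ (H K : Subgroup G) (_ : H.Normal) (_ : K.Normal), K ≤ H ∧
    IsFrobeniusWithKernel H (K.subgroupOf H) ∧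
    IsFrobeniusWithKernel (G ⧸ K) (H.map (QuotientGroup.mk' K))

/-- The action of the cyclic group of order 4 on the cyclic group of order 15 (both written
multiplicatively) in which the generator acts, in additive notation, as multiplication by `2`,
a unit of order 4 modulo 15. Since `2 * 8 = 1` modulo 15, the inverse uses powers of `8`. -/
def actionC4C15 : Multiplicative (ZMod 4) →* MulAut (Multiplicative (ZMod 15)) where
  toFun k :=
    { toFun := fun x => Multiplicative.ofAdd ((2 : ZMod 15) ^ k.toAdd.val * x.toAdd)
      invFun := fun x => Multiplicative.ofAdd ((8 : ZMod 15) ^ k.toAdd.val * x.toAdd)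
      left_inv := by revert k; decide
      right_inv := by revert k; decide
      map_mul' := fun x y => congrArg Multiplicative.ofAdd (mul_add _ x.toAdd y.toAdd) }
  map_one' := by
    ext x
    simp
  map_mul' := by
    intro k l
    have h : ∀ k l : ZMod 4, (2 : ZMod 15) ^ (k + l).val = 2 ^ k.val * 2 ^ l.val := by decide
    ext x
    change (2 : ZMod 15) ^ (k.toAdd + l.toAdd).val * x.toAdd
      = 2 ^ k.toAdd.val * (2 ^ l.toAdd.val * x.toAdd)
    rw [h, mul_assoc]

/-- The group `SmallGroup(60,7)` of the GAP Small Groups Library: the semidirect product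
`C₁₅ ⋊ C₄` in which a generator of `C₄` acts on `C₁₅` by `x ↦ x ^ 2`, so that it acts faithfully
on the subgroup of order 5 and by inversion on the subgroup of order 3. -/
abbrev SmallGroup60_7 : Type :=
  Multiplicative (ZMod 15) ⋊[actionC4C15] Multiplicative (ZMod 4)

/-! Write N = G', which is abelian. Transfer gives N ∩ Z(G) = 1, so the nontrivial elements of N are
vertices forming a clique, and any x centralizing one of them is within 1 of the clique. If C_N(x) =
1, then G = N C_G(x) (`exists_mul_commute`). Were every noncentral d in C_G(x) also to act freely on
N, G/Z(G) would be Frobenius (`isFrobenius_quotient_center`). So some such d commutes with some n ≠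
1 in N. For any y with C_N(y) = 1, a translate md with m in N commutes with y, and also with n as N
is abelian. Thus n is within 2 of every vertex, and the diameter is at most 4.

For sharpness, two conjugate complements C₄ in the group of order 60 have no commuting pair of
nontrivial elements, so their generators are at distance at least 4. -/

/-! ### Distances in the commuting graph. -/

theorem commutingGraph_edist_le_one {G : Type*} [Group G] {x y : {g : G // g ∉ Subgroup.center G}}
    (h : Commute (x : G) y) : (commutingGraph G).edist x y ≤ 1 := by
  rw [SimpleGraph.edist_le_one_iff_adj_or_eq]
  by_cases hxy : x = y
  · exact Or.inr hxy
  · exact Or.inl ⟨hxy, h⟩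

/-- Since `a` and `b` may coincide with each other or with `x`, walks shorter than 3 are covered by
repeating vertices. -/
theorem commutingGraph_four_le_edist {G : Type*} [Group G]
    {x y : {g : G // g ∉ Subgroup.center G}}
    (hfar : ∀ a b : {g : G // g ∉ Subgroup.center G}, Commute (x : G) a → Commute (a : G) b →
      Commute (b : G) y → False) : 4 ≤ (commutingGraph G).edist x y := by
  rw [SimpleGraph.edist_eq_sInf]
  refine le_sInf ?_
  rintro _ ⟨p, rfl⟩
  refine Nat.cast_le.2 (?_ : 4 ≤ p.length)
  match p with
  | .nil => exact (hfar x x (Commute.refl _) (Commute.refl _) (Commute.refl _)).elim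
  | .cons h .nil => exact (hfar _ _ (Commute.refl _) (Commute.refl _) h.2).elim
  | .cons h (.cons h' .nil) => exact (hfar _ _ (Commute.refl _) h.2 h'.2).elim
  | .cons h (.cons h' (.cons h'' .nil)) => exact (hfar _ _ h.2 h'.2 h''.2).elim
  | .cons _ (.cons _ (.cons _ (.cons _ q))) => simp only [SimpleGraph.Walk.length_cons]; omega

/-! ### The derived subgroup, the center and centralizers. -/

theorem commute_of_hasDerivedLength_two {G : Type*} [Group G] (h : HasDerivedLength G 2) {a b : G}
    (ha : a ∈ commutator G) (hb : b ∈ commutator G) : Commute a b := by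
  have h2 : derivedSeries G 2 = ⊥ := h.1
  rw [derivedSeries_succ, derivedSeries_one, Subgroup.commutator_eq_bot_iff_le_centralizer] at h2
  exact (Subgroup.mem_centralizer_iff.1 (h2 ha) b hb).symm

/-- In an `A`-group, no nontrivial central element lies in the derived subgroup. -/
theorem IsAGroup.disjoint_commutator_center {G : Type*} [Group G] [Finite G] (hA : IsAGroup G) :
    Disjoint (commutator G) (Subgroup.center G) := by
  rw [disjoint_iff]
  by_contra hne
  have hcard : Nat.card (commutator G ⊓ Subgroup.center G : Subgroup G) ≠ 1 :=
    fun h => hne (Subgroup.card_eq_one.1 h)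
  obtain ⟨p, hp, hdvd⟩ := Nat.exists_prime_and_dvd hcard
  have : Fact p.Prime := ⟨hp⟩
  obtain ⟨⟨z, hz, hzc⟩, hord⟩ := exists_prime_orderOf_dvd_card' p hdvd
  replace hord : orderOf z = p := (Subgroup.orderOf_coe _).trans hord
  have hpz : IsPGroup p (Subgroup.zpowers z) :=
    IsPGroup.of_card (n := 1) (by rw [Nat.card_zpowers, hord, pow_one])
  obtain ⟨P, hP⟩ := hpz.exists_le_sylow
  have hzP : z ∈ P := hP (Subgroup.mem_zpowers z)
  let _ : CommGroup P := { (inferInstance : Group P) with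
    mul_comm := fun a b => Subtype.ext (hA p hp P a a.2 b b.2) }
  -- On the central z the transfer into P is z ^ [G : P]; as P is abelian, it also kills G'. Hence p
  -- divides [G : P], which is absurd.
  have hpow := MonoidHom.transfer_eq_pow (MonoidHom.id (P : Subgroup G)) z
    (fun k g₀ _ => by
      have hzk : z ^ k ∈ Subgroup.center G := pow_mem hzc k
      rw [mul_assoc, ← Subgroup.mem_center_iff.1 hzk g₀, inv_mul_cancel_left])
  have hker : MonoidHom.transfer (MonoidHom.id (P : Subgroup G)) z = 1 :=
    
    MonoidHom.mem_ker.1 (Abelianization.commutator_subset_ker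
      (MonoidHom.transfer (MonoidHom.id (P : Subgroup G))) hz)
  rw [hker] at hpow
  have hone : z ^ (P : Subgroup G).index = 1 := (congrArg Subtype.val hpow).symm
  have hdiv : p ∣ (P : Subgroup G).index := 
    hord.symm.dvd.trans (orderOf_dvd_of_pow_eq_one hone)
  exact P.not_dvd_index hdiv

/-- If `x` centralizes no nontrivial element of the finite normal subgroup `N`, then every element
of `N` is a commutator of an element of `N` with `x`. -/
theorem exists_conj_mul_inv_eq {G : Type*} [Group G] {N : Subgroup G} [N.Normal] [Finite N]
    {x : G} (hx : ∀ n ∈ N, Commute x n → n = 1) {k : G} (hk : k ∈ N) :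
    ∃ m ∈ N, m * x * m⁻¹ * x⁻¹ = k := by
  have hmem : ∀ m : N, (m : G) * x * (m : G)⁻¹ * x⁻¹ ∈ N := fun m => by
    have := N.mul_mem m.2 (Subgroup.Normal.conj_mem ‹N.Normal› _ (N.inv_mem m.2) x)
    simpa [mul_assoc] using this
  have hinj : Function.Injective fun m : N => (⟨_, hmem m⟩ : N) := by
    intro a b hab
    have h : (a : G) * x * (a : G)⁻¹ * x⁻¹ = b * x * (b : G)⁻¹ * x⁻¹ := congrArg Subtype.val hab
    have h1 : (a : G) * x * (a : G)⁻¹ = b * x * (b : G)⁻¹ := mul_right_cancel h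
    -- Equal commutators with x force b⁻¹a to centralize x; finiteness then turns injectivity into
    -- surjectivity.
    have hc : Commute x ((b : G)⁻¹ * a) := by
      have h2 : (a : G) * x = b * x * (b : G)⁻¹ * a := by rw [← h1]; group
      change x * ((b : G)⁻¹ * a) = (b : G)⁻¹ * a * x
      rw [mul_assoc (b : G)⁻¹, h2]; group
    have := hx _ (N.mul_mem (N.inv_mem b.2) a.2) hc
    exact Subtype.ext (inv_mul_eq_one.1 this).symm
  obtain ⟨m, hm⟩ := (Finite.injective_iff_surjective.1 hinj) ⟨k, hk⟩
  exact ⟨m, m.2, congrArg Subtype.val hm⟩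

/-- A Frattini argument: g and some m in G' conjugate x to the same element, so m⁻¹g centralizes x.
-/
theorem exists_mul_commute {G : Type*} [Group G] [Finite G] {x : G}
    (hx : ∀ n ∈ commutator G, Commute x n → n = 1) (g : G) :
    ∃ m ∈ commutator G, Commute x (m * g) := by
  have hg : g * x * g⁻¹ * x⁻¹ ∈ commutator G :=
    Subgroup.commutator_mem_commutator (Subgroup.mem_top g) (Subgroup.mem_top x)
  obtain ⟨m, hm, h⟩ := exists_conj_mul_inv_eq hx hg
  refine ⟨m⁻¹, inv_mem hm, ?_⟩
  have h1 : m * x * m⁻¹ = g * x * g⁻¹ := mul_right_cancel h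
  calc x * (m⁻¹ * g) = m⁻¹ * (m * x * m⁻¹) * g := by group
    _ = m⁻¹ * g * x := by rw [h1]; group

/-- If `x` centralizes no nontrivial element of the derived subgroup and `C_G(x)` acts freely on it
modulo the center, then `G / Z(G)` is a Frobenius group with complement `C_G(x) / Z(G)`. -/
theorem isFrobenius_quotient_center {G : Type*} [Group G] [Finite G]
    (hN : commutator G ≠ ⊥) (hZ : Disjoint (commutator G) (Subgroup.center G))
    {x : G} (hxZ : x ∉ Subgroup.center G) (hx : ∀ n ∈ commutator G, Commute x n → n = 1)
    (hfree : ∀ d, Commute x d → d ∉ Subgroup.center G →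
      ∀ n ∈ commutator G, Commute d n → n = 1) :
    IsFrobenius (G ⧸ Subgroup.center G) := by
  have hZ' : ∀ n ∈ commutator G, n ∈ Subgroup.center G → n = 1 := fun n h1 h2 =>
    Subgroup.disjoint_def.1 hZ h1 h2
  have hcZ : ∀ z ∈ Subgroup.center G, ∀ g, Commute g z := fun z hz g =>
    Subgroup.mem_center_iff.1 hz g
  refine ⟨(commutator G).map (QuotientGroup.mk' _),
    Subgroup.Normal.map inferInstance _ (QuotientGroup.mk'_surjective _), ?_,
    (Subgroup.centralizer {x}).map (QuotientGroup.mk' _), ?_, ?_, ?_⟩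
  · intro h
    refine hN ((Subgroup.eq_bot_iff_forall _).2 fun n hn => hZ' n hn ?_)
    rw [Subgroup.map_eq_bot_iff, QuotientGroup.ker_mk'] at h
    exact h hn
  · intro h
    rw [Subgroup.map_eq_bot_iff, QuotientGroup.ker_mk'] at h
    exact hxZ (h (Subgroup.mem_centralizer_singleton_iff.2 rfl))
  · apply Subgroup.isComplement'_of_disjoint_and_mul_eq_univ
    · rw [Subgroup.disjoint_def]
      rintro _ ⟨n, hn, rfl⟩ ⟨c, hc, hcn⟩
      have hz : c⁻¹ * n ∈ Subgroup.center G := QuotientGroup.eq.1 hcn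
      have hxc : Commute x c := (Subgroup.mem_centralizer_singleton_iff.1 hc).symm
      have : Commute x n := by
        have := hxc.mul_right (hcZ _ hz x)
        rwa [mul_inv_cancel_left] at this
      rw [hx n hn this, map_one]
    · refine Set.eq_univ_of_forall fun g => ?_
      obtain ⟨g, rfl⟩ := QuotientGroup.mk'_surjective _ g
      obtain ⟨m, hm, hc⟩ := exists_mul_commute hx g
      refine ⟨_, ⟨m⁻¹, inv_mem hm, rfl⟩, _,
        ⟨m * g, Subgroup.mem_centralizer_singleton_iff.2 hc.symm, rfl⟩, ?_⟩
      simp only [← map_mul, inv_mul_cancel_left]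
  · rintro _ ⟨a, ha, rfl⟩ ha1 _ ⟨n, hn, rfl⟩ hn1 h
    have haZ : a ∉ Subgroup.center G := fun h => ha1 ((QuotientGroup.eq_one_iff a).2 h)
    have hne : n ≠ 1 := fun h => hn1 (by rw [h, map_one])
    apply hne
    refine hfree a (Subgroup.mem_centralizer_singleton_iff.1 ha).symm haZ n hn ?_
    -- This element lies in G' ∩ Z(G) = 1, so commuting modulo the center lifts to commuting in G.
    have hz : n⁻¹ * (a * n * a⁻¹) ∈ Subgroup.center G := QuotientGroup.eq.1 h.symm
    have hmem : n⁻¹ * (a * n * a⁻¹) ∈ commutator G :=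
      mul_mem (inv_mem hn) (Subgroup.Normal.conj_mem inferInstance n hn a)
    have h1 := hZ' _ hmem hz
    have h2 : n = a * n * a⁻¹ := inv_mul_eq_one.1 h1
    exact (eq_mul_inv_iff_mul_eq.1 h2).symm

/-! ### The diameter bound. -/

theorem commutingGraph_ediam_le_four {G : Type*} [Group G] [Finite G] (hA : IsAGroup G)
    (hd : HasDerivedLength G 2) (hF : ¬ IsFrobenius (G ⧸ Subgroup.center G)) :
    (commutingGraph G).ediam ≤ 4 := by
  have hZ := hA.disjoint_commutator_center
  have hN : commutator G ≠ ⊥ := fun h => by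
    have : 2 ≤ 1 := hd.2 (show derivedSeries G 1 = ⊥ by rw [derivedSeries_one, h])
    omega
  have hnc : ∀ n ∈ commutator G, n ≠ 1 → n ∉ Subgroup.center G := fun n hn h1 hz =>
    h1 (Subgroup.disjoint_def.1 hZ hn hz)
  set Γ := commutingGraph G
  let V := {g : G // g ∉ Subgroup.center G}
  have hNN : ∀ u v : V, (u : G) ∈ commutator G → (v : G) ∈ commutator G → Γ.edist u v ≤ 1 :=
    fun u v hu hv => commutingGraph_edist_le_one (commute_of_hasDerivedLength_two hd hu hv)
  have hclose : ∀ x : V, (∃ n ∈ commutator G, Commute (x : G) n ∧ n ≠ 1) →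
      ∃ v : V, (v : G) ∈ commutator G ∧ Γ.edist x v ≤ 1 := by
    rintro x ⟨n, hn, hc, h1⟩
    exact ⟨⟨n, hnc n hn h1⟩, hn, commutingGraph_edist_le_one hc⟩
  have hadd : ∀ {u v w : V} {i j : ℕ∞}, Γ.edist u v ≤ i → Γ.edist v w ≤ j → Γ.edist u w ≤ i + j :=
    fun h1 h2 => SimpleGraph.edist_triangle.trans (add_le_add h1 h2)
  have hfar : ∃ v : V, (v : G) ∈ commutator G ∧
      ∀ x : V, (¬ ∃ n ∈ commutator G, Commute (x : G) n ∧ n ≠ 1) → Γ.edist x v ≤ 2 := by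
    by_cases hall : ∀ x : V, ∃ n ∈ commutator G, Commute (x : G) n ∧ n ≠ 1
    · obtain ⟨n, hn, h1⟩ := (Subgroup.bot_or_exists_ne_one _).resolve_left hN
      exact ⟨⟨n, hnc _ hn h1⟩, hn, fun x hx => absurd (hall x) hx⟩
    · push Not at hall
      obtain ⟨⟨x, hxZ⟩, hx⟩ := hall
      have hdn : ∃ d, Commute x d ∧ d ∉ Subgroup.center G ∧
          ∃ n ∈ commutator G, Commute d n ∧ n ≠ 1 := by
        by_contra hcon
        push Not at hcon
        exact hF (isFrobenius_quotient_center hN hZ hxZ hx hcon)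
      obtain ⟨d, hxd, hdZ, n, hn, hdn, h1⟩ := hdn
      -- The vertex n comes from x alone and serves every y.
      refine ⟨⟨n, hnc n hn h1⟩, hn, fun y hy => ?_⟩
      push Not at hy
      obtain ⟨m, hm, hc⟩ := exists_mul_commute hy d
      -- If md were central, m would centralize x, so m = 1 and d would be central.
      have hmd : m * d ∉ Subgroup.center G := fun hz => by
        have hxm : Commute x m := by
          have := (show Commute x (m * d) from Subgroup.mem_center_iff.1 hz x).mul_right
            hxd.inv_right
          rwa [mul_inv_cancel_right] at this
        rw [hx m hm hxm, one_mul] at hz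
        exact hdZ hz
      have e1 : Γ.edist y ⟨m * d, hmd⟩ ≤ 1 := commutingGraph_edist_le_one hc
      have e2 : Γ.edist ⟨m * d, hmd⟩ ⟨n, hnc n hn h1⟩ ≤ 1 := commutingGraph_edist_le_one
        ((commute_of_hasDerivedLength_two hd hm hn).mul_left hdn)
      exact (hadd e1 e2).trans (by norm_num)
  obtain ⟨v, hv, hfar⟩ := hfar
  have hto : ∀ x : V, Γ.edist x v ≤ 2 := fun x => by
    by_cases hx : ∃ n ∈ commutator G, Commute (x : G) n ∧ n ≠ 1
    · obtain ⟨w, hw, hxw⟩ := hclose x hx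
      exact (hadd hxw (hNN w v hw hv)).trans (by norm_num)
    · exact hfar x hx
  rw [SimpleGraph.ediam_le_iff]
  intro x y
  exact (hadd (hto x) (SimpleGraph.edist_comm (G := Γ) ▸ hto y)).trans (by norm_num)

theorem commutingGraph_connected_of_ediam_le_four {G : Type*} [Group G]
    (hG : ¬ ∀ x y : G, x * y = y * x) (h : (commutingGraph G).ediam ≤ 4) :
    (commutingGraph G).Connected := by
  push Not at hG
  obtain ⟨x, y, hxy⟩ := hG
  have : Nonempty {g : G // g ∉ Subgroup.center G} :=
    ⟨⟨x, fun hx => hxy (Subgroup.mem_center_iff.1 hx y).symm⟩⟩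
  exact SimpleGraph.connected_of_ediam_ne_top (ne_top_of_le_ne_top (by decide) h)

/-! ### Obstructions to being Frobenius or 2-Frobenius. -/

theorem IsFrobeniusWithKernel.le_commutator {G : Type*} [Group G] [Finite G] {N : Subgroup G}
    (h : IsFrobeniusWithKernel G N) : N ≤ commutator G := by
  obtain ⟨hN, -, A, hA, -, hfree⟩ := h
  obtain ⟨⟨a, ha⟩, ha1⟩ := (Subgroup.ne_bot_iff_exists_ne_one (H := A)).1 hA
  intro k hk
  obtain ⟨m, -, rfl⟩ := exists_conj_mul_inv_eq (x := a) (fun n hn hc => by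
    by_contra hne
    exact hfree a ha (fun h => ha1 (Subtype.ext h)) n hn hne (mul_inv_eq_iff_eq_mul.2 hc)) hk
  exact Subgroup.commutator_mem_commutator (Subgroup.mem_top m) (Subgroup.mem_top a)

theorem IsFrobeniusWithKernel.exists_not_commute {G : Type*} [Group G] {N : Subgroup G}
    (h : IsFrobeniusWithKernel G N) : ∃ a b : G, ¬ Commute a b := by
  obtain ⟨-, hN, A, hA, -, hfree⟩ := h
  obtain ⟨⟨a, ha⟩, ha1⟩ := (Subgroup.ne_bot_iff_exists_ne_one (H := A)).1 hA
  obtain ⟨⟨n, hn⟩, hn1⟩ := (Subgroup.ne_bot_iff_exists_ne_one (H := N)).1 hN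
  exact ⟨a, n, fun hc => hfree a ha (fun h => ha1 (Subtype.ext h)) n hn
    (fun h => hn1 (Subtype.ext h)) (mul_inv_eq_iff_eq_mul.2 hc)⟩

/-- A finite 2-Frobenius group is not metabelian. -/
theorem not_isTwoFrobenius_of_derivedSeries_two {G : Type*} [Group G] [Finite G]
    (h : derivedSeries G 2 = ⊥) : ¬ IsTwoFrobenius G := by
  rintro ⟨H, K, hH, hK, hKH, hHK, hQ⟩
  rw [derivedSeries_succ, derivedSeries_one, Subgroup.commutator_eq_bot_iff_le_centralizer] at h
  have hK' : K ≤ commutator G := fun k hk => by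
    have h1 : (⟨k, hKH hk⟩ : H) ∈ commutator H := hHK.le_commutator hk
    have h2 : (commutator H).map H.subtype ≤ commutator G := by
      rw [commutator_def, Subgroup.map_commutator]
      exact Subgroup.commutator_mono le_top le_top
    exact h2 ⟨_, h1, rfl⟩
  -- Because K ≤ G', the inclusion of H/K in (G/K)' pulls back to G. Then H is abelian, unlike a
  -- Frobenius group.
  have hH' : H ≤ commutator G := fun x hx => by
    have h1 := hQ.le_commutator ⟨x, hx, rfl⟩
    rw [← derivedSeries_one, ← map_derivedSeries_eq (QuotientGroup.mk'_surjective K),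
      derivedSeries_one, ← Subgroup.mem_comap,
      Subgroup.comap_map_eq_self (by rwa [QuotientGroup.ker_mk'])] at h1
    exact h1
  obtain ⟨a, b, hab⟩ := hHK.exists_not_commute
  exact hab (Subtype.ext (Subgroup.mem_centralizer_iff.1 (h (hH' b.2)) a (hH' a.2)))

/-- The complement acts on N \ {1} by conjugation with trivial stabilizers, so its order divides |N|
- 1. -/
theorem IsFrobeniusWithKernel.exists_card_dvd {G : Type*} [Group G] [Finite G] {N : Subgroup G}
    (h : IsFrobeniusWithKernel G N) : ∃ a : ℕ, 1 < a ∧ 1 < Nat.card N ∧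
      Nat.card N * a = Nat.card G ∧ a ∣ Nat.card N - 1 := by
  obtain ⟨hN, hN1, A, hA, hcompl, hfree⟩ := h
  refine ⟨Nat.card A, (Subgroup.one_lt_card_iff_ne_bot A).2 hA,
    (Subgroup.one_lt_card_iff_ne_bot N).2 hN1, hcompl.card_mul_card, ?_⟩
  let _ : MulAction A {n : N // n ≠ 1} :=
    { smul := fun a n => ⟨⟨a * n * (a : G)⁻¹, hN.conj_mem _ n.1.2 _⟩, fun h => n.2 (by
        have h1 : (a : G) * n * (a : G)⁻¹ = 1 := congrArg Subtype.val h
        exact Subtype.ext (conj_eq_one_iff.1 h1))⟩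
      one_smul := fun n => Subtype.ext (Subtype.ext (by
        change ((1 : A) : G) * n * ((1 : A) : G)⁻¹ = n
        simp))
      mul_smul := fun a b n => Subtype.ext (Subtype.ext (by
        change ((a * b : A) : G) * n * ((a * b : A) : G)⁻¹ = a * (b * n * (b : G)⁻¹) * (a : G)⁻¹
        simp [mul_assoc])) }
  have hstab : ∀ n : {n : N // n ≠ 1}, MulAction.stabilizer A n = ⊥ := fun n => by
    rw [Subgroup.eq_bot_iff_forall]
    intro a ha
    by_contra hne
    exact hfree a a.2 (fun h => hne (Subtype.ext h)) n n.1.2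
      (fun h => n.2 (Subtype.ext h)) (congrArg (fun m : {n : N // n ≠ 1} => ((m : N) : G)) ha)
  have hcard := Nat.card_congr (MulAction.selfEquivOrbitsQuotientProd hstab)
  rw [Nat.card_prod] at hcard
  have hsub : Nat.card {n : N // n ≠ 1} = Nat.card N - 1 := by
    have := Fintype.ofFinite N
    classical
    rw [Nat.card_eq_fintype_card, Nat.card_eq_fintype_card, Fintype.card_subtype_compl,
      Fintype.card_subtype_eq]
  exact ⟨_, by rw [← hsub, hcard, mul_comm]⟩

theorem not_isFrobenius_of_card_eq_sixty {G : Type*} [Group G] [Finite G]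
    (h : Nat.card G = 60) : ¬ IsFrobenius G := by
  rintro ⟨N, hN⟩
  obtain ⟨a, ha, hn, hmul, hdvd⟩ := hN.exists_card_dvd
  rw [h] at hmul
  generalize Nat.card N = n at *
  have hle : n ≤ 60 := Nat.le_of_dvd (by norm_num) ⟨a, hmul.symm⟩
  have hna : a = 60 / n := by rw [← hmul, Nat.mul_div_cancel_left _ (by omega)]
  subst hna
  interval_cases n <;> revert hmul hdvd ha <;> decide

/-! ### The example of order 60. -/

theorem SmallGroup60_7.card_eq : Nat.card SmallGroup60_7 = 60 := by
  rw [SemidirectProduct.card]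
  simp [Nat.card_eq_fintype_card, ZMod.card]

theorem SmallGroup60_7.commute_iff (a b : SmallGroup60_7) : Commute a b ↔
    a.left.toAdd + (2 : ZMod 15) ^ a.right.toAdd.val * b.left.toAdd =
      b.left.toAdd + (2 : ZMod 15) ^ b.right.toAdd.val * a.left.toAdd := by
  constructor
  · intro h
    exact congrArg (fun g : SmallGroup60_7 => g.left.toAdd) h
  · intro h
    exact SemidirectProduct.ext h (mul_comm a.right b.right)

instance SmallGroup60_7.finite : Finite SmallGroup60_7 :=
  Nat.finite_of_card_ne_zero (by rw [SmallGroup60_7.card_eq]; norm_num)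

theorem SmallGroup60_7.center_eq_bot : Subgroup.center SmallGroup60_7 = ⊥ := by
  rw [Subgroup.eq_bot_iff_forall]
  rintro ⟨k, c⟩ h
  have h1 := (SmallGroup60_7.commute_iff _ _).1
    (Subgroup.mem_center_iff.1 h ⟨Multiplicative.ofAdd 1, 1⟩)
  have h2 := (SmallGroup60_7.commute_iff _ _).1
    (Subgroup.mem_center_iff.1 h ⟨1, Multiplicative.ofAdd 1⟩)
  have key : ∀ (k : ZMod 15) (c : ZMod 4),
      (1 + (2 : ZMod 15) ^ (0 : ZMod 4).val * k = k + 2 ^ c.val * 1) →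
      (0 + (2 : ZMod 15) ^ (1 : ZMod 4).val * k = k + 2 ^ c.val * 0) → k = 0 ∧ c = 0 := by decide
  obtain ⟨hk, hc⟩ := key k.toAdd c.toAdd h1 h2
  exact SemidirectProduct.ext hk hc

theorem SmallGroup60_7.derivedSeries_two : derivedSeries SmallGroup60_7 2 = ⊥ := by
  rw [derivedSeries_succ, derivedSeries_one, Subgroup.commutator_eq_bot_iff_le_centralizer]
  have h : ∀ a ∈ commutator SmallGroup60_7, a.right = 1 := fun a ha =>
    (Abelianization.commutator_subset_ker SemidirectProduct.rightHom ha :)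
  intro a ha
  rw [Subgroup.mem_centralizer_iff]
  intro b hb
  refine (SmallGroup60_7.commute_iff b a).2 ?_
  rw [h a ha, h b hb]
  simp [add_comm]

theorem SmallGroup60_7.not_commutative : ¬ ∀ x y : SmallGroup60_7, x * y = y * x := fun h => by
  have : (⟨Multiplicative.ofAdd 1, 1⟩ : SmallGroup60_7) ∈ Subgroup.center SmallGroup60_7 :=
    Subgroup.mem_center_iff.2 fun g => h g _
  rw [SmallGroup60_7.center_eq_bot, Subgroup.mem_bot] at this
  have h1 : (1 : ZMod 15) = 0 := congrArg (fun g : SmallGroup60_7 => g.left.toAdd) this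
  exact absurd h1 (by decide)

theorem SmallGroup60_7.hasDerivedLength : HasDerivedLength SmallGroup60_7 2 := by
  refine ⟨SmallGroup60_7.derivedSeries_two, fun k hk => ?_⟩
  by_contra hlt
  have h1 : derivedSeries SmallGroup60_7 1 = ⊥ :=
    le_bot_iff.1 ((derivedSeries_antitone SmallGroup60_7 (by omega : k ≤ 1)).trans_eq hk)
  rw [derivedSeries_one, commutator_def, Subgroup.commutator_eq_bot_iff_le_centralizer] at h1
  exact SmallGroup60_7.not_commutative fun x y =>
    Subgroup.mem_centralizer_iff.1 (h1 (Subgroup.mem_top y)) x (Subgroup.mem_top x)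

theorem SmallGroup60_7.isAGroup : IsAGroup SmallGroup60_7 := by
  intro p hp P x hx y hy
  have : Fact p.Prime := ⟨hp⟩
  have hcard := P.card_eq_multiplicity
  rw [SmallGroup60_7.card_eq] at hcard
  -- No cube of a prime divides 60, so Sylow subgroups have order 1, p or p², hence are abelian.
  have hle : Nat.factorization 60 p ≤ 2 := by
    by_contra hlt
    have hdvd : p ^ 3 ∣ 60 :=
      (hp.pow_dvd_iff_le_factorization (by norm_num)).2 (by omega)
    have hp4 : p < 4 := lt_of_pow_lt_pow_left₀ 3 (by norm_num)
      ((Nat.le_of_dvd (by norm_num) hdvd).trans_lt (by norm_num))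
    interval_cases p <;> revert hdvd hp <;> norm_num
  suffices h : ∀ a b : P, a * b = b * a from congrArg Subtype.val (h ⟨x, hx⟩ ⟨y, hy⟩)
  generalize Nat.factorization 60 p = k at *
  interval_cases k
  · have : Subsingleton P := (Nat.card_eq_one_iff_unique.1 (by simpa using hcard)).1
    exact fun a b => Subsingleton.elim _ _
  · have := isCyclic_of_prime_card (by simpa using hcard)
    exact fun a b => IsCyclic.isMulCommutative.is_comm.comm a b
  · have := IsPGroup.isMulCommutative_of_card_eq_prime_sq hcard
    exact fun a b => mul_comm' a b

theorem SmallGroup60_7.four_le_ediam : 4 ≤ (commutingGraph SmallGroup60_7).ediam := by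
  -- The endpoints are (0, 1) and (1, 1): if (k, c) centralizes the first, (l, d) the second, and
  -- they commute, one of them is trivial.
  have key : ∀ (k l : ZMod 15) (c d : ZMod 4),
      0 + (2 : ZMod 15) ^ (1 : ZMod 4).val * k = k + 2 ^ c.val * 0 →
      1 + (2 : ZMod 15) ^ (1 : ZMod 4).val * l = l + 2 ^ d.val * 1 →
      k + (2 : ZMod 15) ^ c.val * l = l + 2 ^ d.val * k → k = 0 ∧ c = 0 ∨ l = 0 ∧ d = 0 := by
    decide
  have hne : ∀ k : ZMod 15, (⟨Multiplicative.ofAdd k, Multiplicative.ofAdd 1⟩ : SmallGroup60_7) ∉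
      Subgroup.center SmallGroup60_7 := fun k h => by
    rw [SmallGroup60_7.center_eq_bot, Subgroup.mem_bot] at h
    have h1 : (1 : ZMod 4) = 0 := congrArg (fun g : SmallGroup60_7 => g.right.toAdd) h
    exact absurd h1 (by decide)
  have hfar : ∀ a b : {g : SmallGroup60_7 // g ∉ Subgroup.center SmallGroup60_7},
      Commute ⟨Multiplicative.ofAdd 0, Multiplicative.ofAdd 1⟩ (a : SmallGroup60_7) →
      Commute (a : SmallGroup60_7) b →
      Commute (b : SmallGroup60_7) ⟨Multiplicative.ofAdd 1, Multiplicative.ofAdd 1⟩ → False := by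
    intro a b ha hab hb
    rcases key _ _ _ _ ((SmallGroup60_7.commute_iff _ _).1 ha)
      ((SmallGroup60_7.commute_iff _ _).1 hb.symm) ((SmallGroup60_7.commute_iff _ _).1 hab) with
      h | h
    · exact a.2 ((SemidirectProduct.ext h.1 h.2 : (a : SmallGroup60_7) = 1) ▸ one_mem _)
    · exact b.2 ((SemidirectProduct.ext h.1 h.2 : (b : SmallGroup60_7) = 1) ▸ one_mem _)
  refine le_trans ?_ (SimpleGraph.edist_le_ediam (u := ⟨_, hne 0⟩) (v := ⟨_, hne 1⟩))
  exact commutingGraph_four_le_edist hfar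

theorem lemma3p3 :
    (∀ (G : Type*) [Group G] [Finite G],
      Group.IsSolvable G →
      (¬ ∀ x y : G, x * y = y * x) →
      IsAGroup G →
      HasDerivedLength G 2 →
      ¬ IsFrobenius (G ⧸ Subgroup.center G) →
      ¬ IsTwoFrobenius (G ⧸ Subgroup.center G) →
      (commutingGraph G).Connected ∧ (commutingGraph G).ediam ≤ 4) ∧
    (Finite SmallGroup60_7 ∧
      Group.IsSolvable SmallGroup60_7 ∧
      (¬ ∀ x y : SmallGroup60_7, x * y = y * x) ∧
      IsAGroup SmallGroup60_7 ∧
      HasDerivedLength SmallGroup60_7 2 ∧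
      ¬ IsFrobenius (SmallGroup60_7 ⧸ Subgroup.center SmallGroup60_7) ∧
      ¬ IsTwoFrobenius (SmallGroup60_7 ⧸ Subgroup.center SmallGroup60_7) ∧
      (commutingGraph SmallGroup60_7).Connected ∧
      (commutingGraph SmallGroup60_7).ediam = 4) := by
  refine ⟨fun G _ _ _ hG hA hd hF _ => ?_, inferInstance,
    ⟨⟨2, SmallGroup60_7.derivedSeries_two⟩⟩, SmallGroup60_7.not_commutative,
    SmallGroup60_7.isAGroup, SmallGroup60_7.hasDerivedLength, ?_⟩
  · have h := commutingGraph_ediam_le_four hA hd hF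
    exact ⟨commutingGraph_connected_of_ediam_le_four hG h, h⟩
  · have hF : ¬ IsFrobenius (SmallGroup60_7 ⧸ Subgroup.center SmallGroup60_7) := by
      refine not_isFrobenius_of_card_eq_sixty ?_
      rw [SmallGroup60_7.center_eq_bot, Nat.card_congr QuotientGroup.quotientBot.toEquiv,
        SmallGroup60_7.card_eq]
    have h := commutingGraph_ediam_le_four SmallGroup60_7.isAGroup
      SmallGroup60_7.hasDerivedLength hF
    refine ⟨hF, not_isTwoFrobenius_of_derivedSeries_two ?_,
      commutingGraph_connected_of_ediam_le_four SmallGroup60_7.not_commutative h,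
      le_antisymm h SmallGroup60_7.four_le_ediam⟩
    rw [← map_derivedSeries_eq (QuotientGroup.mk'_surjective _),
      SmallGroup60_7.derivedSeries_two, Subgroup.map_bot]
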